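/- For a lattice $K$, let $\mathrm{Con}\,K$ be the complete lattice of all congruences of $K$ and let $\mathrm{Con}_c K$ be the $\langle\vee,0\rangle$-semilattice of its compact elements. For a lattice homomorphism $f\colon K\to L$, let $\mathrm{Con}_c f\colon \mathrm{Con}_c K\to\mathrm{Con}_c L$ be the $\langle\vee,0\rangle$-homomorphism that sends a compact congruence $\alpha$ of $K$ to the least congruence of $L$ containing all pairs $(f(x),f(y))$ with $(x,y)\in\alpha$. A truncated square $\mathcal D$ of Boolean lattices consists of Boolean lattices $B_0,B_1,B_2$ and homomorphisms $e_1\colon B_0\to B_1$, $e_2\colon B_0\to B_2$ of Boolean lattices (lattice homomorphisms preserving $0$ and $1$). For a $\langle\vee,0\rangle$-semilattice $S$, a homomorphism $\varphi\colon\mathrm{Con}_c\mathcal D\to S$ is a triple of $\langle\vee,0\rangle$-homomorphisms $\varphi_i\colon\mathrm{Con}_c B_i\to S$ ($i<3$) such that $\varphi_1\circ\mathrm{Con}_c e_1=\varphi_0=\varphi_2\circ\mathrm{Con}_c e_2$. It can be lifted through a lattice $L$ if there are lattice homomorphisms $g_i\colon B_i\to L$ ($i<3$) with $g_1\circ e_1=g_0=g_2\circ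 e_2$ and an isomorphism $\psi\colon\mathrm{Con}_c L\to S$ such that $\varphi_i=\psi\circ\mathrm{Con}_c g_i$ for all $i<3$. Corollary. Let $S$ be a $\langle\vee,0\rangle$-semilattice such that, for every truncated square $\mathcal D$ of Boolean lattices, every homomorphism $\varphi\colon\mathrm{Con}_c\mathcal D\to S$ can be lifted through some lattice. Then $S$ is a distributive lattice, and it is conditionally complete: every nonempty subset of $S$ that has an upper bound in $S$ has a least upper bound in $S$. -/

import Mathlib

universe u v w

/-! ### The lattice of congruences of a lattice -/

namespace LatticeCon

variable {K : Type u} [Lattice K]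

theorem ext_r {c d : LatticeCon K} (h : ∀ x y, c.r x y ↔ d.r x y) : c = d := by
  obtain ⟨s, _, _⟩ := c
  obtain ⟨t, _, _⟩ := d
  have : s = t := Setoid.ext h
  subst this
  rfl

/-- Congruences of a lattice are ordered by inclusion (as binary relations). -/
instance : PartialOrder (LatticeCon K) where
  le c d := ∀ x y, c.r x y → d.r x y
  le_refl _ _ _ h := h
  le_trans _ _ _ h₁ h₂ x y h := h₂ x y (h₁ x y h)
  le_antisymm _ _ h₁ h₂ := ext_r fun x y => ⟨h₁ x y, h₂ x y⟩

theorem le_iff {c d : LatticeCon K} : c ≤ d ↔ ∀ x y, c.r x y → d.r x y := Iff.rfl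

/-- The infimum of a set of congruences is its intersection. -/
instance : InfSet (LatticeCon K) where
  sInf C :=
    { r := fun x y => ∀ c ∈ C, c.r x y
      iseqv :=
        ⟨fun x c _ => c.refl x, fun h c hc => c.symm (h c hc),
          fun h₁ h₂ c hc => c.trans (h₁ c hc) (h₂ c hc)⟩
      inf := fun h₁ h₂ c hc => c.inf (h₁ c hc) (h₂ c hc)
      sup := fun h₁ h₂ c hc => c.sup (h₁ c hc) (h₂ c hc) }

theorem sInf_r {C : Set (LatticeCon K)} {x y : K} :
    (sInf C).r x y ↔ ∀ c ∈ C, c.r x y := Iff.rfl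

/-- The complete lattice `Con K` of all congruences of `K`, under inclusion. -/
instance : CompleteLattice (LatticeCon K) :=
  completeLatticeOfInf _ fun _ =>
    ⟨fun _ hc _ _ h => h _ hc, fun _ hd x y h _ hc => hd hc x y h⟩

/-- The union of a nonempty directed set of congruences is its supremum. -/
theorem sSup_r_of_directedOn {C : Set (LatticeCon K)} (hne : C.Nonempty)
    (hC : DirectedOn (· ≤ ·) C) {x y : K} :
    (sSup C).r x y ↔ ∃ c ∈ C, c.r x y := by
  constructor
  · let d : LatticeCon K :=
      { r := fun x y => ∃ c ∈ C, c.r x y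
        iseqv := by
          refine ⟨fun x => ?_, ?_, ?_⟩
          · obtain ⟨c, hc⟩ := hne
            exact ⟨c, hc, c.refl x⟩
          · rintro x y ⟨c, hc, h⟩
            exact ⟨c, hc, c.symm h⟩
          · rintro x y z ⟨c, hc, h⟩ ⟨c', hc', h'⟩
            obtain ⟨e, he, h₁, h₂⟩ := hC c hc c' hc'
            exact ⟨e, he, e.trans (h₁ _ _ h) (h₂ _ _ h')⟩
        inf := by
          rintro w x y z ⟨c, hc, h⟩ ⟨c', hc', h'⟩
          obtain ⟨e, he, h₁, h₂⟩ := hC c hc c' hc'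
          exact ⟨e, he, e.inf (h₁ _ _ h) (h₂ _ _ h')⟩
        sup := by
          rintro w x y z ⟨c, hc, h⟩ ⟨c', hc', h'⟩
          obtain ⟨e, he, h₁, h₂⟩ := hC c hc c' hc'
          exact ⟨e, he, e.sup (h₁ _ _ h) (h₂ _ _ h')⟩ }
    have hd : sSup C ≤ d := sSup_le fun c hc x y h => ⟨c, hc, h⟩
    exact hd x y
  · rintro ⟨c, hc, h⟩
    exact le_sSup hc x y h

theorem isCompactElement_bot : IsCompactElement (⊥ : LatticeCon K) :=
  fun _ _ ⟨c, hc⟩ _ _ _ => ⟨c, hc, bot_le⟩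

theorem isCompactElement_sup {c d : LatticeCon K} (hc : IsCompactElement c)
    (hd : IsCompactElement d) : IsCompactElement (c ⊔ d) := by
  intro s u hne hdir hu hle
  obtain ⟨x, hx, hcx⟩ := hc s u hne hdir hu (le_sup_left.trans hle)
  obtain ⟨y, hy, hdy⟩ := hd s u hne hdir hu (le_sup_right.trans hle)
  obtain ⟨z, hz, hxz, hyz⟩ := hdir x hx y hy
  exact ⟨z, hz, sup_le (hcx.trans hxz) (hdy.trans hyz)⟩

variable {L : Type v} [Lattice L]

/-- `(Con f) c` is the least congruence of `L` that contains all pairs `(f x, f y)` with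
`(x, y) ∈ c`. -/
def map (f : LatticeHom K L) (c : LatticeCon K) : LatticeCon L :=
  sInf {d | ∀ x y, c.r x y → d.r (f x) (f y)}

/-- The inverse image of a congruence under a lattice homomorphism. -/
def comap (f : LatticeHom K L) (d : LatticeCon L) : LatticeCon K where
  r x y := d.r (f x) (f y)
  iseqv := ⟨fun x => d.refl (f x), fun h => d.symm h, fun h₁ h₂ => d.trans h₁ h₂⟩
  inf h₁ h₂ := by simpa only [map_inf] using d.inf h₁ h₂
  sup h₁ h₂ := by simpa only [map_sup] using d.sup h₁ h₂

theorem map_comap_gc (f : LatticeHom K L) : GaloisConnection (map f) (comap f) := by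
  intro c d
  constructor
  · intro h x y hxy
    exact h _ _ fun e he => he x y hxy
  · intro h x y hxy
    exact hxy d h

theorem isCompactElement_map (f : LatticeHom K L) {c : LatticeCon K}
    (hc : IsCompactElement c) : IsCompactElement (map f c) := by
  rw [CompleteLattice.isCompactElement_iff_le_of_directed_sSup_le] at hc ⊢
  intro D hne hdir hle
  have hdir' : DirectedOn (· ≤ ·) (comap f '' D) := by
    rintro _ ⟨d, hd, rfl⟩ _ ⟨d', hd', rfl⟩
    obtain ⟨e, he, h₁, h₂⟩ := hdir d hd d' hd'
    exact ⟨_, ⟨e, he, rfl⟩, (map_comap_gc f).monotone_u h₁, (map_comap_gc f).monotone_u h₂⟩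
  have hle' : c ≤ sSup (comap f '' D) := by
    intro x y hxy
    obtain ⟨d, hd, h⟩ := (sSup_r_of_directedOn hne hdir).1 ((map_comap_gc f c _).1 hle x y hxy)
    exact (sSup_r_of_directedOn (hne.image _) hdir').2 ⟨_, ⟨d, hd, rfl⟩, h⟩
  obtain ⟨_, ⟨d, hd, rfl⟩, h⟩ := hc _ (hne.image _) hdir' hle'
  exact ⟨d, hd, (map_comap_gc f c d).2 h⟩

end LatticeCon

/-! ### The functor `Con_c` of compact congruences -/

/-- `Con_c K`: the compact elements of the lattice of congruences of the lattice `K`. -/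
def Conc (K : Type u) [Lattice K] : Type u :=
  {c : LatticeCon K // IsCompactElement c}

namespace Conc

variable {K : Type u} [Lattice K] {L : Type v} [Lattice L]

/-- `Con_c K` is a join-semilattice, with the order and the joins of `Con K`. -/
instance : SemilatticeSup (Conc K) :=
  Subtype.semilatticeSup fun _ _ h₁ h₂ => LatticeCon.isCompactElement_sup h₁ h₂

/-- The zero element of `Con_c K` is the identity congruence. -/
instance : OrderBot (Conc K) :=
  Subtype.orderBot LatticeCon.isCompactElement_bot

/-- The map `Con_c f`, that is, `Con f` restricted to the compact congruences. -/
def map (f : LatticeHom K L) : SupBotHom (Conc K) (Conc L) where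
  toFun c := ⟨LatticeCon.map f c.1, LatticeCon.isCompactElement_map f c.2⟩
  map_sup' _ _ := Subtype.ext (LatticeCon.map_comap_gc f).l_sup
  map_bot' := Subtype.ext (LatticeCon.map_comap_gc f).l_bot

end Conc

/-! ### Truncated squares and liftings -/

/-- Given a truncated square `f₁ : K₀ → K₁`, `f₂ : K₀ → K₂` of lattices, a homomorphism from its
image under `Con_c` to a join-semilattice `S` with zero. -/
structure ConcSquareHom {K₀ K₁ K₂ : Type u} [Lattice K₀] [Lattice K₁] [Lattice K₂]
    (f₁ : LatticeHom K₀ K₁) (f₂ : LatticeHom K₀ K₂)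
    (S : Type w) [SemilatticeSup S] [OrderBot S] where
  φ₀ : SupBotHom (Conc K₀) S
  φ₁ : SupBotHom (Conc K₁) S
  φ₂ : SupBotHom (Conc K₂) S
  comm₁ : φ₁.comp (Conc.map f₁) = φ₀
  comm₂ : φ₂.comp (Conc.map f₂) = φ₀

/-- The homomorphism `φ` can be lifted through the lattice `L`: there are a homomorphism
`(g₀, g₁, g₂)` from the truncated square to `L` and an isomorphism `ψ : Con_c L → S` with
`φᵢ = ψ ∘ Con_c gᵢ` for each `i`. -/
def ConcSquareHom.LiftsThrough {K₀ K₁ K₂ : Type u} [Lattice K₀] [Lattice K₁] [Lattice K₂]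
    {f₁ : LatticeHom K₀ K₁} {f₂ : LatticeHom K₀ K₂}
    {S : Type w} [SemilatticeSup S] [OrderBot S]
    (φ : ConcSquareHom f₁ f₂ S) (L : Type v) [Lattice L] : Prop :=
  ∃ (g₀ : LatticeHom K₀ L) (g₁ : LatticeHom K₁ L) (g₂ : LatticeHom K₂ L) (ψ : Conc L ≃o S),
    g₁.comp f₁ = g₀ ∧ g₂.comp f₂ = g₀ ∧
    (∀ c, φ.φ₀ c = ψ (Conc.map g₀ c)) ∧
    (∀ c, φ.φ₁ c = ψ (Conc.map g₁ c)) ∧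
    (∀ c, φ.φ₂ c = ψ (Conc.map g₂ c))

/-- A partially ordered set is conditionally complete if every nonempty subset with an upper bound
has a least upper bound. -/
def IsConditionallyComplete (P : Type u) [PartialOrder P] : Prop :=
  ∀ X : Set P, X.Nonempty → BddAbove X → ∃ s, IsLUB X s

/-!
If `K` is any lattice, `Con K` is distributive, so `Con_c K` is a distributive semilattice; hence so
is `S`, which is isomorphic to some `Con_c L`. In a semilattice with zero, conditional completeness
means that every nonempty subset has a greatest lower bound, and it provides binary meets. A
distributive semilattice with meets is a distributive lattice. So everything reduces to the existence
of greatest lower bounds of nonempty sets.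

The semilattice `Con_c B` of a Boolean lattice `B` is `B` itself (`BooleanAlgebra.concIso`), so a
homomorphism from a truncated square to `S` is a pair of join-homomorphisms `μ₁ : B₁ → S`,
`μ₂ : B₂ → S` which agree on `B₀`. Suppose that it is lifted by `g₁, g₂` through `L`, and let `c ∈ B₁`,
`d ∈ B₂`. The least congruence of `L` that puts `g₁ c` below `g₂ d` is compact, so it corresponds to
an element `s` of `S`. It is at least `μ a` for each `a ∈ B₀` below `c` and disjoint from `d`, and at
most every `t` for which some `z ∈ B₀` has `μ₁ (c \ z) ≤ t` and `μ₂ (z \ d) ≤ t`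
(`LiftsBooleanSquares.exists_between`).

Given an element `b` and an antitone family `u` over a well-ordered set `ι`, let `X` be the set of
their common lower bounds. A suitable square of algebras of subsets of `X ⊕ ι` makes such an `s`
the greatest element of `X` (`LiftsBooleanSquares.exists_isGLB_insert_range`): `a` runs over the
singletons of `X` and `z` over the initial segments of `ι`. A transfinite induction along a
well-ordering of an arbitrary nonempty set then yields its greatest lower bound.
-/

/-! ### Distributivity of the semilattice of compact congruences -/

namespace LatticeCon

variable {K : Type u} [Lattice K]

/-- The congruence generated by a pair. -/
def principal (x y : K) : LatticeCon K := sInf {c | c.r x y}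

theorem principal_le_iff {x y : K} {c : LatticeCon K} : principal x y ≤ c ↔ c.r x y :=
  ⟨fun h => h x y fun _ hd => hd, fun h => sInf_le h⟩

theorem isCompactElement_of_le_iff {c : LatticeCon K} {x y : K} (h : ∀ d, c ≤ d ↔ d.r x y) :
    IsCompactElement c := by
  rw [CompleteLattice.isCompactElement_iff_le_of_directed_sSup_le]
  intro D hne hdir hle
  obtain ⟨d, hd, hxy⟩ := (sSup_r_of_directedOn hne hdir).1 ((h _).1 hle)
  exact ⟨d, hd, (h d).2 hxy⟩

theorem isCompactElement_principal (x y : K) : IsCompactElement (principal x y) :=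
  isCompactElement_of_le_iff fun _ => principal_le_iff

/-- The join of two congruences is the transitive closure of their union. -/
theorem sup_r_imp_eqvGen {c d : LatticeCon K} {x y : K} (h : (c ⊔ d).r x y) :
    Relation.EqvGen (fun a b => c.r a b ∨ d.r a b) x y := by
  let R : K → K → Prop := fun a b => c.r a b ∨ d.r a b
  have lift_op : ∀ op : K → K → K, (∀ z a b, R a b → R (op a z) (op b z)) →
      (∀ z a b, R a b → R (op z a) (op z b)) → ∀ w x y z, Relation.EqvGen R w x →
      Relation.EqvGen R y z → Relation.EqvGen R (op w y) (op x z) := by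
    intro op hl hr w x y z h₁ h₂
    have map_eqvGen : ∀ f : K → K, (∀ a b, R a b → R (f a) (f b)) → ∀ a b,
        Relation.EqvGen R a b → Relation.EqvGen R (f a) (f b) := by
      intro f hf a b hab
      induction hab with
      | rel a b h => exact .rel _ _ (hf a b h)
      | refl a => exact .refl _
      | symm a b _ ih => exact .symm _ _ ih
      | trans a b c _ _ ih₁ ih₂ => exact .trans _ _ _ ih₁ ih₂
    exact .trans _ _ _ (map_eqvGen (fun a => op a y) (hl y) w x h₁)
      (map_eqvGen (fun a => op x a) (hr x) y z h₂)
  let e : LatticeCon K :=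
    { r := Relation.EqvGen R
      iseqv := Relation.EqvGen.is_equivalence R
      inf := fun h₁ h₂ => lift_op (· ⊓ ·)
        (fun z _ _ => Or.imp (fun h => c.inf h (c.refl z)) fun h => d.inf h (d.refl z))
        (fun z _ _ => Or.imp (fun h => c.inf (c.refl z) h) fun h => d.inf (d.refl z) h) _ _ _ _ h₁ h₂
      sup := fun h₁ h₂ => lift_op (· ⊔ ·)
        (fun z _ _ => Or.imp (fun h => c.sup h (c.refl z)) fun h => d.sup h (d.refl z))
        (fun z _ _ => Or.imp (fun h => c.sup (c.refl z) h) fun h => d.sup (d.refl z) h)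
        _ _ _ _ h₁ h₂ }
  have hc : c ≤ e := fun a b h => .rel a b (Or.inl h)
  have hd : d ≤ e := fun a b h => .rel a b (Or.inr h)
  exact sup_le hc hd x y h

/-- Congruence lattices of lattices are distributive, since lattices have a majority term. -/
theorem inf_sup_le (a b c : LatticeCon K) : a ⊓ (b ⊔ c) ≤ (a ⊓ b) ⊔ (a ⊓ c) := by
  intro x y hxy
  have hax : a.r x y := (inf_le_left : a ⊓ (b ⊔ c) ≤ a) x y hxy
  have hgen := sup_r_imp_eqvGen ((inf_le_right : a ⊓ (b ⊔ c) ≤ b ⊔ c) x y hxy)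
  let e := (a ⊓ b) ⊔ (a ⊓ c)
  let m : K → K := fun z => x ⊓ z ⊔ z ⊓ y ⊔ y ⊓ x
  have hm : ∀ f : LatticeCon K, ∀ {z w}, f.r z w → f.r (m z) (m w) := fun f z w h =>
    f.sup (f.sup (f.inf (f.refl x) h) (f.inf h (f.refl y))) (f.refl _)
  -- Modulo `a`, the points `x` and `y` agree, so all values of `m` agree with `x`.
  have ham : ∀ z, a.r (m z) x := by
    intro z
    have h : a.r (m z) (x ⊓ z ⊔ z ⊓ x ⊔ x ⊓ x) :=
      a.sup (a.sup (a.refl _) (a.inf (a.refl z) (a.symm hax))) (a.inf (a.symm hax) (a.refl x))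
    have hx : x ⊓ z ⊔ z ⊓ x ⊔ x ⊓ x = x := by
      rw [inf_idem, inf_comm z x, sup_idem]
      exact sup_eq_right.2 inf_le_left
    rwa [hx] at h
  have haa : ∀ z w, a.r (m z) (m w) := fun z w => a.trans (ham z) (a.symm (ham w))
  have hinf : ∀ f : LatticeCon K, ∀ z w, f.r z w → (a ⊓ f).r (m z) (m w) := by
    intro f z w h
    have hle : principal (m z) (m w) ≤ a ⊓ f :=
      le_inf (principal_le_iff.2 (haa z w)) (principal_le_iff.2 (hm f h))
    exact principal_le_iff.1 hle
  have key : ∀ z w, Relation.EqvGen (fun z w => b.r z w ∨ c.r z w) z w → e.r (m z) (m w) := by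
    intro z w h
    induction h with
    | rel z w h =>
      rcases h with h | h
      · exact (le_sup_left : a ⊓ b ≤ e) _ _ (hinf b z w h)
      · exact (le_sup_right : a ⊓ c ≤ e) _ _ (hinf c z w h)
    | refl z => exact e.refl _
    | symm z w _ ih => exact e.symm ih
    | trans z w v _ _ ih₁ ih₂ => exact e.trans ih₁ ih₂
  have h := key x y hgen
  have hx : m x = x := by
    change x ⊓ x ⊔ x ⊓ y ⊔ y ⊓ x = x
    rw [inf_idem, inf_comm y x, sup_assoc, sup_idem]
    exact sup_eq_left.2 inf_le_left
  have hy : m y = y := by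
    change x ⊓ y ⊔ y ⊓ y ⊔ y ⊓ x = y
    rw [inf_idem, sup_eq_right.2 (inf_le_right : x ⊓ y ≤ y)]
    exact sup_eq_left.2 inf_le_left
  rwa [hx, hy] at h

end LatticeCon

namespace Conc

variable {K : Type u} [Lattice K]

/-- The compact congruence generated by a pair. -/
def principal (x y : K) : Conc K :=
  ⟨LatticeCon.principal x y, LatticeCon.isCompactElement_principal x y⟩

theorem principal_le_iff {x y : K} {c : Conc K} : principal x y ≤ c ↔ c.1.r x y :=
  LatticeCon.principal_le_iff

/-- The semilattice `Con_c K` is distributive. -/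
theorem exists_sup_eq_of_le_sup {a b c : Conc K} (h : a ≤ b ⊔ c) :
    ∃ b' ≤ b, ∃ c' ≤ c, a = b' ⊔ c' := by
  let D : Set (LatticeCon K) :=
    {d | ∃ b' c' : Conc K, b'.1 ≤ a.1 ⊓ b.1 ∧ c'.1 ≤ a.1 ⊓ c.1 ∧ d = b'.1 ⊔ c'.1}
  have hne : D.Nonempty := ⟨_, ⊥, ⊥, bot_le, bot_le, rfl⟩
  have hdir : DirectedOn (· ≤ ·) D := by
    rintro _ ⟨b₁, c₁, hb₁, hc₁, rfl⟩ _ ⟨b₂, c₂, hb₂, hc₂, rfl⟩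
    exact ⟨_, ⟨b₁ ⊔ b₂, c₁ ⊔ c₂, sup_le hb₁ hb₂, sup_le hc₁ hc₂, rfl⟩,
      sup_le_sup (show b₁.1 ≤ b₁.1 ⊔ b₂.1 from le_sup_left)
        (show c₁.1 ≤ c₁.1 ⊔ c₂.1 from le_sup_left),
      sup_le_sup (show b₂.1 ≤ b₁.1 ⊔ b₂.1 from le_sup_right)
        (show c₂.1 ≤ c₁.1 ⊔ c₂.1 from le_sup_right)⟩
  have hsup : a.1 ≤ sSup D := by
    have hdist : a.1 ≤ (a.1 ⊓ b.1) ⊔ (a.1 ⊓ c.1) :=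
      (le_inf le_rfl h).trans (LatticeCon.inf_sup_le a.1 b.1 c.1)
    refine hdist.trans (sup_le (fun x y hxy => ?_) fun x y hxy => ?_)
    · have hmem : (principal x y).1 ∈ D :=
        ⟨principal x y, ⊥, LatticeCon.principal_le_iff.2 hxy, bot_le, (sup_bot_eq _).symm⟩
      exact LatticeCon.principal_le_iff.1 (le_sSup hmem)
    · have hmem : (principal x y).1 ∈ D :=
        ⟨⊥, principal x y, bot_le, LatticeCon.principal_le_iff.2 hxy, (bot_sup_eq _).symm⟩
      exact LatticeCon.principal_le_iff.1 (le_sSup hmem)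
  obtain ⟨_, ⟨b', c', hb, hc, rfl⟩, hle⟩ :=
    (CompleteLattice.isCompactElement_iff_le_of_directed_sSup_le _ a.1).1 a.2 D hne hdir hsup
  exact ⟨b', hb.trans inf_le_right, c', hc.trans inf_le_right,
    le_antisymm hle (sup_le (hb.trans inf_le_left) (hc.trans inf_le_left))⟩

end Conc

/-! ### Compact congruences of Boolean algebras -/

namespace BooleanAlgebra

variable {B : Type u} [BooleanAlgebra B]

/-- The congruence of a Boolean algebra that corresponds to the principal ideal below `a`. -/
def idealCon (a : B) : LatticeCon B where
  r x y := x ⊔ a = y ⊔ a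
  iseqv := ⟨fun _ => rfl, Eq.symm, Eq.trans⟩
  inf {w x y z} h₁ h₂ := by rw [sup_inf_right, sup_inf_right, h₁, h₂]
  sup {w x y z} h₁ h₂ := by rw [sup_sup_distrib_right w, sup_sup_distrib_right x, h₁, h₂]

theorem idealCon_le_iff {a : B} {c : LatticeCon B} : idealCon a ≤ c ↔ c.r ⊥ a := by
  refine ⟨fun h => h ⊥ a (show ⊥ ⊔ a = a ⊔ a by simp), fun h x y hxy => ?_⟩
  have h' : ∀ z : B, c.r z (z ⊔ a) := fun z => by simpa using c.sup (c.refl z) h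
  have hy : c.r (x ⊔ a) y := by
    rw [show x ⊔ a = y ⊔ a from hxy]
    exact c.symm (h' y)
  exact c.trans (h' x) hy

/-- The element `a`, seen as a compact congruence. -/
def toConc (a : B) : Conc B :=
  ⟨idealCon a, LatticeCon.isCompactElement_of_le_iff fun _ => idealCon_le_iff⟩

theorem toConc_le_iff {a : B} {c : Conc B} : toConc a ≤ c ↔ c.1.r ⊥ a := idealCon_le_iff

theorem toConc_le_toConc {a b : B} : toConc a ≤ toConc b ↔ a ≤ b := by
  rw [toConc_le_iff]
  change ⊥ ⊔ b = a ⊔ b ↔ _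
  rw [bot_sup_eq, eq_comm, sup_eq_right]

theorem toConc_surjective : Function.Surjective (toConc : B → Conc B) := by
  intro c
  let D : Set (LatticeCon B) := {d | ∃ a, c.1.r ⊥ a ∧ d = idealCon a}
  have hne : D.Nonempty := ⟨_, ⊥, c.1.refl ⊥, rfl⟩
  have hdir : DirectedOn (· ≤ ·) D := by
    rintro _ ⟨a, ha, rfl⟩ _ ⟨b, hb, rfl⟩
    exact ⟨_, ⟨a ⊔ b, by simpa using c.1.sup ha hb, rfl⟩,
      toConc_le_toConc.2 le_sup_left, toConc_le_toConc.2 le_sup_right⟩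
  have hsup : c.1 ≤ sSup D := by
    intro x y hxy
    have hmem : ∀ {a b : B}, c.1.r a b → idealCon (a \ b) ∈ D := by
      intro a b h
      refine ⟨a \ b, ?_, rfl⟩
      simpa [sdiff_eq] using c.1.inf (c.1.symm h) (c.1.refl bᶜ)
    refine (sSup D).trans (b := x ⊔ y) ?_ ?_
    · refine le_sSup (hmem (c.1.symm hxy)) _ _ ?_
      change x ⊔ y \ x = x ⊔ y ⊔ y \ x
      rw [sup_sdiff_self_right, sup_assoc, sup_eq_left.2 (sdiff_le : y \ x ≤ y)]
    · refine le_sSup (hmem hxy) _ _ ?_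
      change x ⊔ y ⊔ x \ y = y ⊔ x \ y
      rw [sup_sdiff_self_right, sup_right_comm, sup_eq_left.2 (sdiff_le : x \ y ≤ x), sup_comm]
  obtain ⟨_, ⟨a, ha, rfl⟩, hle⟩ :=
    (CompleteLattice.isCompactElement_iff_le_of_directed_sSup_le _ c.1).1 c.2 D hne hdir hsup
  exact ⟨a, le_antisymm (toConc_le_iff.2 ha) hle⟩

/-- The semilattice of compact congruences of a Boolean algebra `B` is isomorphic to `B`. -/
noncomputable def concIso (B : Type u) [BooleanAlgebra B] : B ≃o Conc B :=
  RelIso.ofSurjective (OrderEmbedding.ofMapLEIff toConc fun _ _ => toConc_le_toConc)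
    toConc_surjective

theorem conc_map_toConc_le_iff {L : Type v} [Lattice L] (g : LatticeHom B L) {a : B} {d : Conc L} :
    Conc.map g (toConc a) ≤ d ↔ d.1.r (g ⊥) (g a) :=
  (LatticeCon.map_comap_gc g _ _).trans idealCon_le_iff

theorem conc_map_toConc {C : Type u} [BooleanAlgebra C] (e : BoundedLatticeHom B C) (a : B) :
    Conc.map e.toLatticeHom (toConc a) = toConc (e a) := by
  refine eq_of_forall_ge_iff fun d => ?_
  rw [conc_map_toConc_le_iff, toConc_le_iff]
  change d.1.r (e ⊥) (e a) ↔ _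
  rw [map_bot]

/-- A join-homomorphism on a Boolean algebra, transported to its compact congruences. -/
noncomputable def concHom {S : Type w} [SemilatticeSup S] [OrderBot S] (μ : SupBotHom B S) :
    SupBotHom (Conc B) S where
  toFun c := μ ((concIso B).symm c)
  map_sup' _ _ := by rw [map_sup, map_sup]
  map_bot' := by rw [map_bot, map_bot]

theorem concHom_toConc {S : Type w} [SemilatticeSup S] [OrderBot S] (μ : SupBotHom B S) (a : B) :
    concHom μ (toConc a) = μ a :=
  congrArg μ ((concIso B).symm_apply_apply a)

end BooleanAlgebra

open BooleanAlgebra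

/-! ### Interpolation from liftings of squares -/

/-- Every homomorphism to `S` from a truncated square of Boolean algebras can be lifted. -/
def LiftsBooleanSquares (S : Type u) [SemilatticeSup S] [OrderBot S] : Prop :=
  ∀ (B₀ B₁ B₂ : Type u) [BooleanAlgebra B₀] [BooleanAlgebra B₁] [BooleanAlgebra B₂]
    (e₁ : BoundedLatticeHom B₀ B₁) (e₂ : BoundedLatticeHom B₀ B₂)
    (φ : ConcSquareHom e₁.toLatticeHom e₂.toLatticeHom S),
    ∃ (L : Type v) (_ : Lattice L), φ.LiftsThrough L

/-- A join-homomorphism is determined by the upper bounds of its values. -/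
theorem exists_supBotHom {B : Type v} {S : Type u} [SemilatticeSup B] [OrderBot B]
    [SemilatticeSup S] [OrderBot S] (P : B → S → Prop) (hex : ∀ a, ∃ m, ∀ t, m ≤ t ↔ P a t)
    (hsup : ∀ a b t, P (a ⊔ b) t ↔ P a t ∧ P b t) (hbot : ∀ t, P ⊥ t) :
    ∃ μ : SupBotHom B S, ∀ a t, μ a ≤ t ↔ P a t := by
  choose m hm using hex
  refine ⟨⟨⟨m, fun a b => eq_of_forall_ge_iff fun t => ?_⟩, ?_⟩, hm⟩
  · rw [hm, hsup, sup_le_iff, hm, hm]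
  · exact le_bot_iff.1 ((hm _ _).2 (hbot _))

namespace LiftsBooleanSquares

variable {S : Type u} [SemilatticeSup S] [OrderBot S]

/-- The element `s` is the congruence that collapses `c \ d` in the lattice of a lifting, although
`c` and `d` lie in different algebras. -/
theorem exists_between (hS : LiftsBooleanSquares.{u, v} S) {B₀ B₁ B₂ : Type u}
    [BooleanAlgebra B₀] [BooleanAlgebra B₁] [BooleanAlgebra B₂]
    (e₁ : BoundedLatticeHom B₀ B₁) (e₂ : BoundedLatticeHom B₀ B₂)
    (μ₁ : SupBotHom B₁ S) (μ₂ : SupBotHom B₂ S) (hμ : ∀ a, μ₁ (e₁ a) = μ₂ (e₂ a))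
    (c : B₁) (d : B₂) :
    ∃ s, (∀ a, e₁ a ≤ c → Disjoint (e₂ a) d → μ₁ (e₁ a) ≤ s) ∧
      ∀ t z, μ₁ (c \ e₁ z) ≤ t → μ₂ (e₂ z \ d) ≤ t → s ≤ t := by
  let φ : ConcSquareHom e₁.toLatticeHom e₂.toLatticeHom S :=
    { φ₀ := (concHom μ₁).comp (Conc.map e₁.toLatticeHom)
      φ₁ := concHom μ₁
      φ₂ := concHom μ₂
      comm₁ := rfl
      comm₂ := by
        refine DFunLike.ext _ _ fun k => ?_
        obtain ⟨a, rfl⟩ := toConc_surjective k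
        simp only [SupBotHom.comp_apply, conc_map_toConc, concHom_toConc, hμ] }
  obtain ⟨L, _, g₀, g₁, g₂, ψ, h₁, h₂, -, hφ₁, hφ₂⟩ := hS B₀ B₁ B₂ e₁ e₂ φ
  have hg : ∀ a, g₁ (e₁ a) = g₂ (e₂ a) := fun a => DFunLike.congr_fun (h₁.trans h₂.symm) a
  have hr₁ : ∀ a t, μ₁ a ≤ t ↔ (ψ.symm t).1.r (g₁ ⊥) (g₁ a) := fun a t => by
    rw [← conc_map_toConc_le_iff, ← ψ.le_iff_le, ψ.apply_symm_apply, ← hφ₁]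
    exact (concHom_toConc μ₁ a).symm ▸ Iff.rfl
  have hr₂ : ∀ a t, μ₂ a ≤ t ↔ (ψ.symm t).1.r (g₂ ⊥) (g₂ a) := fun a t => by
    rw [← conc_map_toConc_le_iff, ← ψ.le_iff_le, ψ.apply_symm_apply, ← hφ₂]
    exact (concHom_toConc μ₂ a).symm ▸ Iff.rfl
  have hs : ∀ t, ψ (Conc.principal (g₁ c ⊔ g₂ d) (g₂ d)) ≤ t ↔
      (ψ.symm t).1.r (g₁ c ⊔ g₂ d) (g₂ d) := fun t => by
    rw [← Conc.principal_le_iff, ← ψ.le_iff_le, ψ.apply_symm_apply]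
  refine ⟨ψ (Conc.principal (g₁ c ⊔ g₂ d) (g₂ d)), fun a hac had => ?_, fun t z h₁ h₂ => ?_⟩
  · rw [hr₁]
    set D := (ψ.symm (ψ (Conc.principal (g₁ c ⊔ g₂ d) (g₂ d)))).1
    have h : D.r (g₁ c ⊔ g₂ d) (g₂ d) := (hs _).1 le_rfl
    have hleft : g₁ (e₁ a) ⊓ (g₁ c ⊔ g₂ d) = g₁ (e₁ a) :=
      inf_eq_left.2 ((OrderHomClass.mono g₁ hac).trans le_sup_left)
    have hright : g₁ (e₁ a) ⊓ g₂ d = g₁ ⊥ := by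
      rw [hg, ← map_inf, had.eq_bot, ← map_bot e₂, ← hg, map_bot]
    have h' := D.inf (D.refl (g₁ (e₁ a))) h
    rw [hleft, hright] at h'
    exact D.symm h'
  · rw [hs]
    rw [hr₁] at h₁
    rw [hr₂] at h₂
    set D := (ψ.symm t).1
    have h₁' : D.r (g₁ (e₁ z)) (g₁ c ⊔ g₁ (e₁ z)) := by
      have := D.sup h₁ (D.refl (g₁ (e₁ z)))
      rwa [← map_sup, ← map_sup, bot_sup_eq, sdiff_sup_self, map_sup] at this
    have h₂' : D.r (g₂ d) (g₁ (e₁ z) ⊔ g₂ d) := by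
      have := D.sup h₂ (D.refl (g₂ d))
      rwa [← map_sup, ← map_sup, bot_sup_eq, sdiff_sup_self, map_sup, ← hg] at this
    have h : D.r (g₂ d) (g₁ c ⊔ g₁ (e₁ z) ⊔ g₂ d) := D.trans h₂' (D.sup h₁' (D.refl _))
    have h' := D.inf h (D.refl (g₁ c ⊔ g₂ d))
    rw [inf_eq_left.2 (le_sup_right : g₂ d ≤ g₁ c ⊔ g₂ d),
      inf_eq_right.2 (sup_le_sup_right le_sup_left _ :
        g₁ c ⊔ g₂ d ≤ g₁ c ⊔ g₁ (e₁ z) ⊔ g₂ d)] at h'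
    exact D.symm h'

end LiftsBooleanSquares

/-! ### Greatest lower bounds -/

/-- The Boolean algebra of the sets decided by a filter. -/
def Filter.decidedSets {α : Type u} (F : Filter α) : BooleanSubalgebra (Set α) where
  carrier := {A | A ∈ F ∨ Aᶜ ∈ F}
  supClosed' A hA A' hA' := by
    rcases hA with hA | hA
    · exact Or.inl (F.mem_of_superset hA Set.subset_union_left)
    rcases hA' with hA' | hA'
    · exact Or.inl (F.mem_of_superset hA' Set.subset_union_right)
    · refine Or.inr ?_
      change (A ∪ A')ᶜ ∈ F
      rw [Set.compl_union]
      exact F.inter_mem hA hA'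
  infClosed' A hA A' hA' := by
    rcases hA with hA | hA
    · rcases hA' with hA' | hA'
      · exact Or.inl (F.inter_mem hA hA')
      · exact Or.inr (F.mem_of_superset hA' (Set.compl_subset_compl.2 Set.inter_subset_right))
    · exact Or.inr (F.mem_of_superset hA (Set.compl_subset_compl.2 Set.inter_subset_left))
  compl_mem' {A} hA := by
    rcases hA with hA | hA
    · exact Or.inr (by rwa [compl_compl])
    · exact Or.inl hA
  bot_mem' := Or.inr (by simp)

theorem Filter.mem_decidedSets {α : Type u} {F : Filter α} {A : Set α} :
    A ∈ F.decidedSets ↔ A ∈ F ∨ Aᶜ ∈ F := Iff.rfl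

theorem exists_le_iff_of_finite {S : Type u} [SemilatticeSup S] [OrderBot S] {A : Set S}
    (hA : A.Finite) : ∃ m, ∀ t, m ≤ t ↔ ∀ x ∈ A, x ≤ t :=
  ⟨hA.toFinset.sup id, fun t => by simp⟩

namespace LiftsBooleanSquares

variable {S : Type u} [SemilatticeSup S] [OrderBot S]

/-- Apply `exists_between` with `c` containing all of `X` and half of each index, and `d` the set of
all indices. Up to the segment `z` of indices below `i`, the difference of `c` and `d` has weight
`u i`; the full set `z = ⊤` gives the bound `b`. -/
theorem exists_isGLB_insert_range (hS : LiftsBooleanSquares.{u, v} S) {ι : Type u}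
    [LinearOrder ι] [WellFoundedLT ι] [Nonempty ι] (u : ι → S) (hu : Antitone u) (b : S) :
    ∃ s, IsGLB (insert b (Set.range u)) s := by
  obtain ⟨i₀, hi₀⟩ : ∃ i₀ : ι, ∀ i, i₀ ≤ i :=
    ⟨wellFounded_lt.min Set.univ Set.univ_nonempty,
      fun i => not_lt.1 (wellFounded_lt.not_lt_min _ (Set.mem_univ i))⟩
  let X := {x : S // x ≤ b ∧ ∀ i, x ≤ u i}
  let e := u i₀ ⊔ b
  have hue : ∀ i, u i ≤ e := fun i => (hu (hi₀ i)).trans le_sup_left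
  -- A set decided by `F` is finite on `X` and bounded on `ι`, or the complement of such a set.
  let F : Filter (X ⊕ ι) := Filter.map Sum.inl Filter.cofinite ⊔ Filter.map Sum.inr Filter.atTop
  have hF : ∀ A : Set (X ⊕ ι), A ∈ F ↔
      (Sum.inl ⁻¹' A)ᶜ.Finite ∧ ∃ i, ∀ j, i ≤ j → Sum.inr j ∈ A := fun A => by
    simp only [F, Filter.mem_sup, Filter.mem_map, Filter.mem_cofinite, Filter.mem_atTop_sets,
      Set.mem_preimage]
  have hfin : ∀ A ∈ F.decidedSets, (∀ i, Sum.inr i ∉ A) → (Sum.inl ⁻¹' A : Set X).Finite := by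
    intro A hA hAι
    rcases hA with hA | hA
    · obtain ⟨i, hi⟩ := ((hF A).1 hA).2
      exact absurd (hi i le_rfl) (hAι i)
    · simpa using ((hF _).1 hA).1
  let ιPart : BoundedLatticeHom (Set (X ⊕ ι)) (Set ι) :=
    { toFun := fun A => Sum.inr ⁻¹' A
      map_sup' := fun _ _ => rfl
      map_inf' := fun _ _ => rfl
      map_top' := rfl
      map_bot' := rfl }
  -- The extension of `F.decidedSets` by an element `c = (⊤, ⊥)` that contains `X` and splits each
  -- index in two: the second factor consists of the elements disjoint from `c`.
  let e₁ : BoundedLatticeHom F.decidedSets (F.decidedSets × Set ι) :=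
    { toFun := fun A => (A, ιPart A.1)
      map_sup' := fun _ _ => rfl
      map_inf' := fun _ _ => rfl
      map_top' := rfl
      map_bot' := rfl }
  let e₂ : BoundedLatticeHom F.decidedSets (Set (X ⊕ ι)) := F.decidedSets.subtype
  -- Below `c` an index `i` has weight `u i`, outside `c` it has weight `e`.
  obtain ⟨μ₁, hμ₁⟩ : ∃ μ₁ : SupBotHom (F.decidedSets × Set ι) S, ∀ A t, μ₁ A ≤ t ↔
      (∀ x, Sum.inl x ∈ A.1.1 → x.1 ≤ t) ∧ (∀ i, Sum.inr i ∈ A.1.1 → u i ≤ t) ∧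
        ∀ i ∈ A.2, e ≤ t := by
    refine exists_supBotHom _ ?_ ?_ ?_
    · rintro ⟨⟨A, hA⟩, T⟩
      obtain ⟨m, hm⟩ : ∃ m : S, ∀ t, m ≤ t ↔
          (∀ x, Sum.inl x ∈ A → x.1 ≤ t) ∧ ∀ i, Sum.inr i ∈ A → u i ≤ t := by
        by_cases hAι : ∃ i, Sum.inr i ∈ A
        · -- The family is antitone, so its values on `A` are bounded by that at the least index.
          refine ⟨u (wellFounded_lt.min {i | Sum.inr i ∈ A} hAι), fun t => ⟨fun h =>
            ⟨fun x _ => (x.2.2 _).trans h, fun i hi => (hu ?_).trans h⟩, fun h =>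
            h.2 _ (wellFounded_lt.min_mem {i | Sum.inr i ∈ A} hAι)⟩⟩
          exact not_lt.1 (wellFounded_lt.not_lt_min {i | Sum.inr i ∈ A} hi)
        · push Not at hAι
          obtain ⟨m, hm⟩ := exists_le_iff_of_finite ((hfin A hA hAι).image Subtype.val)
          refine ⟨m, fun t => (hm t).trans ⟨fun h => ⟨fun x hx => h _ ⟨x, hx, rfl⟩,
            fun i hi => absurd hi (hAι i)⟩, ?_⟩⟩
          rintro h _ ⟨x, hx, rfl⟩
          exact h.1 x hx
      obtain ⟨n, hn⟩ := exists_le_iff_of_finite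
        ((Set.finite_singleton e).subset (Set.sep_subset _ fun _ => T.Nonempty))
      refine ⟨m ⊔ n, fun t => ?_⟩
      rw [sup_le_iff, hm, hn, and_assoc]
      simp [Set.Nonempty]
    · rintro ⟨A, T⟩ ⟨A', T'⟩ t
      change (∀ x, _ ∨ _ → _) ∧ (∀ i, _ ∨ _ → _) ∧ (∀ i, _ ∨ _ → _) ↔ _
      simp only [or_imp, forall_and]
      tauto
    · intro t
      exact ⟨fun _ h => h.elim, fun _ h => h.elim, fun _ h => h.elim⟩
  -- Every index has weight `e`, and infinite subsets of `X` are sent to `b`, which bounds `X`.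
  obtain ⟨μ₂, hμ₂⟩ : ∃ μ₂ : SupBotHom (Set (X ⊕ ι)) S, ∀ A t, μ₂ A ≤ t ↔
      (∀ x, Sum.inl x ∈ A → x.1 ≤ t) ∧ ((Sum.inl ⁻¹' A : Set X).Infinite → b ≤ t) ∧
        ∀ i, Sum.inr i ∈ A → e ≤ t := by
    refine exists_supBotHom _ ?_ ?_ ?_
    · intro A
      obtain ⟨m, hm⟩ : ∃ m : S, ∀ t, m ≤ t ↔
          (∀ x, Sum.inl x ∈ A → x.1 ≤ t) ∧ ((Sum.inl ⁻¹' A : Set X).Infinite → b ≤ t) := by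
        by_cases hA : (Sum.inl ⁻¹' A : Set X).Finite
        · obtain ⟨m, hm⟩ := exists_le_iff_of_finite (hA.image Subtype.val)
          refine ⟨m, fun t => (hm t).trans ⟨fun h => ⟨fun x hx => h _ ⟨x, hx, rfl⟩,
            fun hi => absurd hA hi⟩, ?_⟩⟩
          rintro h _ ⟨x, hx, rfl⟩
          exact h.1 x hx
        · exact ⟨b, fun t => ⟨fun h => ⟨fun x _ => x.2.1.trans h, fun _ => h⟩, fun h => h.2 hA⟩⟩
      obtain ⟨n, hn⟩ := exists_le_iff_of_finite
        ((Set.finite_singleton e).subset (Set.sep_subset _ fun _ => ∃ i, Sum.inr i ∈ A))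
      refine ⟨m ⊔ n, fun t => ?_⟩
      rw [sup_le_iff, hm, hn, and_assoc]
      simp
    · intro A A' t
      change (∀ x, _ ∨ _ → _) ∧ ((Sum.inl ⁻¹' A ∪ Sum.inl ⁻¹' A' : Set X).Infinite → _) ∧
        (∀ i, _ ∨ _ → _) ↔ _
      simp only [Set.infinite_union, or_imp, forall_and]
      tauto
    · intro t
      exact ⟨fun _ h => h.elim, fun h => absurd Set.finite_empty h, fun _ h => h.elim⟩
  have hμ : ∀ A, μ₁ (e₁ A) = μ₂ (e₂ A) := by
    refine fun A => eq_of_forall_ge_iff fun t => ?_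
    rw [hμ₁, hμ₂]
    refine ⟨fun h => ⟨h.1, fun hinf => ?_, h.2.2⟩,
      fun h => ⟨h.1, fun i hi => (hue i).trans (h.2.2 i hi), h.2.2⟩⟩
    obtain ⟨i, hi⟩ : ∃ i, Sum.inr i ∈ A.1 := by
      by_contra hcon
      exact hinf (hfin A.1 A.2 (not_exists.1 hcon))
    exact le_sup_right.trans (h.2.2 i hi)
  obtain ⟨s, hlow, hupp⟩ := hS.exists_between e₁ e₂ μ₁ μ₂ hμ (⊤, ⊥) (Set.range Sum.inr)
  refine ⟨s, ?_, fun x hx => ?_⟩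
  · rintro t (rfl | ⟨i, rfl⟩)
    · refine hupp t ⊤ ((hμ₁ _ _).2 ⟨fun x _ => x.2.1, ?_, ?_⟩) ((hμ₂ _ _).2 ⟨fun x _ => x.2.1,
        fun _ => le_rfl, fun i hi => absurd (Set.mem_range_self i) hi.2⟩)
      · exact fun i hi => absurd (Set.mem_univ _) hi.2
      · exact fun i hi => hi.1.elim
    · let z : F.decidedSets := ⟨Sum.inr '' Set.Iio i, Or.inr ((hF _).2 ⟨by simp, i, fun j hj => by
        simpa using hj⟩)⟩
      refine hupp (u i) z ((hμ₁ _ _).2 ⟨fun x _ => x.2.2 i, fun j hj => hu ?_, ?_⟩)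
        ((hμ₂ _ _).2 ⟨fun x _ => x.2.2 i, fun hinf => absurd ?_ hinf, ?_⟩)
      · exact not_lt.1 fun hji => hj.2 ⟨j, hji, rfl⟩
      · exact fun j hj => hj.1.elim
      · refine Set.finite_empty.subset ?_
        rintro x ⟨⟨j, _, hj⟩, _⟩
        exact absurd hj Sum.inr_ne_inl
      · exact fun j hj => absurd (Set.mem_range_self j) hj.2
  · let x' : X := ⟨x, hx (Set.mem_insert _ _), fun i => hx (Set.mem_insert_of_mem _ ⟨i, rfl⟩)⟩
    let a : F.decidedSets := ⟨{Sum.inl x'}, Or.inr ((hF _).2 ⟨by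
      refine (Set.finite_singleton x').subset fun y hy => ?_
      simpa using hy, i₀, fun j _ => by simp⟩)⟩
    refine ((hμ₁ _ _).1 (hlow a ⟨le_top, ?_⟩ ?_)).1 x' rfl
    · exact fun j hj => absurd hj Sum.inr_ne_inl
    · exact Set.disjoint_singleton_left.2 fun ⟨j, hj⟩ => absurd hj Sum.inr_ne_inl

/-- By induction on `i`, the values at indices up to `i` have a greatest lower bound: those of the
earlier segments form an antitone family, to which `f i` is added. -/
theorem exists_isGLB_range (hS : LiftsBooleanSquares.{u, v} S) {ι : Type u} [LinearOrder ι]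
    [WellFoundedLT ι] [Nonempty ι] (f : ι → S) : ∃ s, IsGLB (Set.range f) s := by
  have hseg : ∀ i : ι, ∃ m, IsGLB (f '' Set.Iic i) m := by
    intro i
    induction i using WellFoundedLT.induction with
    | _ i ih =>
    rcases isEmpty_or_nonempty (Set.Iio i) with hi | hi
    · refine ⟨f i, ?_, fun x hx => hx ⟨i, le_rfl, rfl⟩⟩
      rintro _ ⟨j, hj, rfl⟩
      rcases (show j ≤ i from hj).eq_or_lt with rfl | h
      · exact le_rfl
      · exact (hi.false ⟨j, h⟩).elim
    choose m hm using fun j : Set.Iio i => ih j.1 j.2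
    have hanti : Antitone m := fun j k hjk =>
      (hm j).mono (hm k) (Set.image_mono (Set.Iic_subset_Iic.2 hjk))
    obtain ⟨s, hs⟩ := hS.exists_isGLB_insert_range m hanti (f i)
    refine ⟨s, ?_, fun x hx => hs.2 ?_⟩
    · rintro _ ⟨j, hj, rfl⟩
      rcases (show j ≤ i from hj).eq_or_lt with rfl | h
      · exact hs.1 (Set.mem_insert _ _)
      · exact (hs.1 (Set.mem_insert_of_mem _ ⟨⟨j, h⟩, rfl⟩)).trans ((hm ⟨j, h⟩).1 ⟨j, le_rfl, rfl⟩)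
    · rintro _ (rfl | ⟨j, rfl⟩)
      · exact hx ⟨i, le_rfl, rfl⟩
      · refine (hm j).2 ?_
        rintro _ ⟨k, hk, rfl⟩
        exact hx ⟨k, (show k ≤ j.1 from hk).trans (le_of_lt j.2), rfl⟩
  choose m hm using hseg
  have hanti : Antitone m := fun j k hjk =>
    (hm j).mono (hm k) (Set.image_mono (Set.Iic_subset_Iic.2 hjk))
  obtain ⟨s, hs⟩ := hS.exists_isGLB_insert_range m hanti (f (Classical.arbitrary ι))
  refine ⟨s, ?_, fun x hx => hs.2 ?_⟩
  · rintro _ ⟨i, rfl⟩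
    exact (hs.1 (Set.mem_insert_of_mem _ ⟨i, rfl⟩)).trans ((hm i).1 ⟨i, le_rfl, rfl⟩)
  · rintro _ (rfl | ⟨j, rfl⟩)
    · exact hx ⟨_, rfl⟩
    · refine (hm j).2 ?_
      rintro _ ⟨k, _, rfl⟩
      exact hx ⟨k, rfl⟩

theorem exists_isGLB (hS : LiftsBooleanSquares.{u, v} S) {U : Set S} (hU : U.Nonempty) :
    ∃ s, IsGLB U s := by
  -- The well-ordering of `U` is unrelated to the order that `U` inherits from `S`.
  obtain ⟨o, ho⟩ := exists_wellFoundedLT U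
  have : Nonempty U := hU.to_subtype
  obtain ⟨s, hs⟩ := @exists_isGLB_range S _ _ hS U o ho _ Subtype.val
  exact ⟨s, by rwa [Subtype.range_coe] at hs⟩

/-- A semilattice for which some square lifts is isomorphic to some `Con_c L`, so distributive. -/
theorem exists_sup_eq_of_le_sup (hS : LiftsBooleanSquares.{u, v} S) {a b c : S}
    (h : a ≤ b ⊔ c) : ∃ b' ≤ b, ∃ c' ≤ c, a = b' ⊔ c' := by
  let φ : ConcSquareHom (BoundedLatticeHom.id PUnit.{u + 1}).toLatticeHom
      (BoundedLatticeHom.id PUnit.{u + 1}).toLatticeHom S :=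
    { φ₀ := ⊥
      φ₁ := ⊥
      φ₂ := ⊥
      comm₁ := rfl
      comm₂ := rfl }
  obtain ⟨L, _, _, _, _, ψ, -⟩ := hS _ _ _ _ _ φ
  have h' : ψ.symm a ≤ ψ.symm b ⊔ ψ.symm c := by rwa [← map_sup, ψ.symm.le_iff_le]
  obtain ⟨b', hb, c', hc, habc⟩ := Conc.exists_sup_eq_of_le_sup h'
  refine ⟨ψ b', (ψ.le_symm_apply).1 hb, ψ c', (ψ.le_symm_apply).1 hc, ?_⟩
  rw [← map_sup, ← habc, ψ.apply_symm_apply]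

end LiftsBooleanSquares

theorem corollaryC (S : Type u) [hS : SemilatticeSup S] [OrderBot S]
    (hlift : ∀ (B₀ B₁ B₂ : Type u) [BooleanAlgebra B₀] [BooleanAlgebra B₁] [BooleanAlgebra B₂]
      (e₁ : BoundedLatticeHom B₀ B₁) (e₂ : BoundedLatticeHom B₀ B₂)
      (φ : ConcSquareHom e₁.toLatticeHom e₂.toLatticeHom S),
      ∃ (L : Type v) (_ : Lattice L), φ.LiftsThrough L) :
    IsConditionallyComplete S ∧
      ∃ D : DistribLattice S, D.toLattice.toSemilatticeSup = hS := by
  have hS' : LiftsBooleanSquares.{u, v} S := hlift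
  refine ⟨fun X _ hX => ?_, ?_⟩
  · obtain ⟨s, hs⟩ := hS'.exists_isGLB hX
    exact ⟨s, isGLB_upperBounds.1 hs⟩
  · have hinf : ∀ a b : S, ∃ m, IsGLB {a, b} m := fun a b =>
      hS'.exists_isGLB (Set.insert_nonempty a {b})
    choose m hm using hinf
    let Λ : Lattice S :=
      { hS with
        inf := m
        inf_le_left := fun a b => (hm a b).1 (Set.mem_insert _ _)
        inf_le_right := fun a b => (hm a b).1 (Set.mem_insert_of_mem _ rfl)
        le_inf := fun a b c hab hac => (hm b c).2 (by
          rintro x (rfl | rfl)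
          exacts [hab, hac]) }
    refine ⟨DistribLattice.ofInfSupLe fun a b c => ?_, rfl⟩
    obtain ⟨b', hb, c', hc, h⟩ :=
      hS'.exists_sup_eq_of_le_sup (inf_le_right : a ⊓ (b ⊔ c) ≤ b ⊔ c)
    have ha : b' ⊔ c' ≤ a := h ▸ inf_le_left
    exact h.le.trans (sup_le_sup (le_inf (le_sup_left.trans ha) hb)
      (le_inf (le_sup_right.trans ha) hc))
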